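/- Let $X$ be a real Banach space, $B_{X^{**}}$ the closed unit ball of $X^{**}$, and regard $X\subseteq X^{**}$ canonically. For $\epsilon\ge 0$, a bounded set $M\subseteq X$ is called $\epsilon$-relatively weakly compact if $\overline{M}^{w^*}\subseteq X+\epsilon B_{X^{**}}$, where $\overline{M}^{w^*}$ is the closure of $M$ in $X^{**}$ for the weak$^*$ topology $\sigma(X^{**},X^*)$. The space $X$ has property $\mathfrak{KM}$ if there is a family $\{M_{n,p}:n,p\in\mathbb N\}$ (with $\mathbb N=\{1,2,\dots\}$) of subsets of $X$ such that (i) $M_{n,p}$ is $\frac1p$-relatively weakly compact for all $n,p\in\mathbb N$; and (ii) for each relatively weakly compact set $C\subseteq X$ and each $p\in\mathbb N$ there is $n\in\mathbb N$ such that $C\subseteq M_{n,p}$. A convex block subsequence of a sequence $(x_n)_{n\in\mathbb N}$ in a Banach space is a sequence $(\tilde x_k)_{k\in\mathbb N}$ of the form $\tilde x_k=\sum_{n\in I_k}a_nx_n$, where the $I_k$ are finite subsets of $\mathbb N$ with $\max(I_k)<\min(I_{k+1})$ and $(a_n)_{n\in\mathbb N}$ is a sequence of non-negative reals with $\sum_{n\in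 I_k}a_n=1$ for all $k$. The space $X$ has Kwapień's property (K) if every $w^*$-convergent sequence in $X^*$ admits a convex block subsequence which converges in the Mackey topology $\mu(X^*,X)$, that is, the topology on $X^*$ of uniform convergence on weakly compact subsets of $X$. **Theorem.** If a real Banach space $X$ has property $\mathfrak{KM}$, then it has property (K). -/

import Mathlib

open Filter Topology

section

variable {X : Type*} [NormedAddCommGroup X] [NormedSpace ℝ X]

/-- A set is weakly compact if it is compact in the weak topology of `X`. -/
def IsWeaklyCompact (C : Set X) : Prop :=
  IsCompact (toWeakSpace ℝ X '' C)

/-- A set is relatively weakly compact if its weak closure is weakly compact. -/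
def IsRelativelyWeaklyCompact (C : Set X) : Prop :=
  IsCompact (closure (toWeakSpace ℝ X '' C))

/-- The `w*`-closure in the bidual `X**` (topology `σ(X**, X*)`) of the canonical image of `M`. -/
def bidualWeakStarClosure (M : Set X) : Set (StrongDual ℝ (StrongDual ℝ X)) :=
  StrongDual.toWeakDual ⁻¹'
    closure (StrongDual.toWeakDual '' (NormedSpace.inclusionInDoubleDual ℝ X '' M))

/-- `M` is `ε`-relatively weakly compact if it is bounded and its `w*`-closure in `X**` is
contained in `X + ε B_{X**}`; the last inclusion is spelled out with elements. -/
def IsEpsRelativelyWeaklyCompact (ε : ℝ) (M : Set X) : Prop :=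
  Bornology.IsBounded M ∧
    ∀ z ∈ bidualWeakStarClosure M, ∃ x : X, ∃ b : StrongDual ℝ (StrongDual ℝ X),
      ‖b‖ ≤ 1 ∧ z = NormedSpace.inclusionInDoubleDual ℝ X x + ε • b

variable (X) in
/-- Property `KM`. The indices run over the positive integers. -/
def HasPropertyKM : Prop :=
  ∃ M : ℕ+ → ℕ+ → Set X,
    (∀ n p : ℕ+, IsEpsRelativelyWeaklyCompact (1 / (p : ℝ)) (M n p)) ∧
    ∀ C : Set X, IsRelativelyWeaklyCompact C → ∀ p : ℕ+, ∃ n : ℕ+, C ⊆ M n p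

/-- `y` is a convex block subsequence of the sequence `x`. The sets `I k` are automatically
nonempty because the coefficients over each of them sum to `1`. -/
def IsConvexBlockSubsequence {E : Type*} [AddCommGroup E] [Module ℝ E] (y x : ℕ → E) : Prop :=
  ∃ (I : ℕ → Finset ℕ) (a : ℕ → ℝ),
    (∀ k, ∀ i ∈ I k, ∀ j ∈ I (k + 1), i < j) ∧
    (∀ n, 0 ≤ a n) ∧
    (∀ k, ∑ n ∈ I k, a n = 1) ∧
    ∀ k, y k = ∑ n ∈ I k, a n • x n

/-- The Mackey topology `μ(X*, X)` on the dual: the topology of uniform convergence on the weakly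
compact subsets of `X`. -/
noncomputable abbrev mackeyTopology (X : Type*) [NormedAddCommGroup X] [NormedSpace ℝ X] :
    TopologicalSpace (StrongDual ℝ X) :=
  (UniformConvergenceCLM.instTopologicalSpace (RingHom.id ℝ) ℝ
    {C : Set X | IsWeaklyCompact C}).induced
      (UniformConvergenceCLM.ofFun (RingHom.id ℝ) ℝ {C : Set X | IsWeaklyCompact C})

variable (X) in
/-- Kwapień's property (K): every `w*`-convergent sequence in `X*` has a convex block subsequence
which converges in the Mackey topology `μ(X*, X)`. -/
def HasPropertyK : Prop :=
  ∀ x : ℕ → StrongDual ℝ X,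
    (∃ l : StrongDual ℝ X,
      Tendsto (fun n => StrongDual.toWeakDual (x n)) atTop (𝓝 (StrongDual.toWeakDual l))) →
    ∃ y : ℕ → StrongDual ℝ X, IsConvexBlockSubsequence y x ∧
      ∃ l' : StrongDual ℝ X, Tendsto y atTop (@nhds _ (mackeyTopology X) l')

end

/-! After subtracting the limit, the functionals f_n tend to 0 pointwise and, by Banach–Steinhaus,
satisfy ‖f_n‖ ≤ B. Each point of the w*-compact closure of M_{n,p} is x + b/p with ‖b‖ ≤ 1, so at
that point the values of the f_m are eventually at most (B+1)/p. A Mazur-type argument (Hahn–Banach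
in C(K), Riesz representation, dominated convergence) makes such an eventual pointwise bound
uniform, up to an additive constant, for some convex combination of late terms
(`exists_tailWeights_abs_le`). A disjoint union of compacta treats finitely many sets at once, so
the k-th block can serve all M_{n,p} with n, p ≤ k. A weakly compact C lies, for each p, in some
M_{n,p}, hence is controlled to within (B+2)/p by all late blocks. -/

open scoped CompactlySupported in
/-- A positive linear functional on `C(K, ℝ)` is continuous along bounded pointwise convergent
sequences with limit zero. -/
theorem tendsto_positive_functional_zero {K : Type*} [TopologicalSpace K] [CompactSpace K]
    [T2Space K] (φ : C(K, ℝ) →ₗ[ℝ] ℝ) (hφ : ∀ f : C(K, ℝ), 0 ≤ f → 0 ≤ φ f)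
    (h : ℕ → C(K, ℝ)) (B : ℝ) (hB : ∀ n z, |h n z| ≤ B)
    (hlim : ∀ z, Tendsto (fun n => h n z) atTop (𝓝 0)) :
    Tendsto (fun n => φ (h n)) atTop (𝓝 0) := by
  let _ : MeasurableSpace K := borel K
  have : BorelSpace K := ⟨rfl⟩
  let ψ : C_c(K, ℝ) →ₗ[ℝ] ℝ :=
    { toFun := fun f => φ f.toContinuousMap
      map_add' := fun f g => map_add φ f.toContinuousMap g.toContinuousMap
      map_smul' := fun c f => map_smul φ c f.toContinuousMap }
  let Λ : C_c(K, ℝ) →ₚ[ℝ] ℝ := PositiveLinearMap.mk₀ ψ fun f hf => hφ f.toContinuousMap hf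
  have hrep : ∀ f : C(K, ℝ), ∫ z, f z ∂(RealRMK.rieszMeasure Λ) = φ f := fun f =>
    RealRMK.integral_rieszMeasure Λ (CompactlySupportedContinuousMap.continuousMapEquiv f)
  have := MeasureTheory.tendsto_integral_of_dominated_convergence
    (μ := RealRMK.rieszMeasure Λ) (F := fun n z => h n z) (f := fun _ => (0 : ℝ))
    (fun _ => B) (fun n => (h n).continuous.aestronglyMeasurable)
    (MeasureTheory.integrable_const B)
    (fun n => Eventually.of_forall fun z => hB n z) (Eventually.of_forall hlim)
  simpa only [hrep, MeasureTheory.integral_zero] using this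

/-! ### Convex combinations of late terms, and uniform bounds in `C(K, ℝ)` -/

/-- The weights of the convex combinations of the terms with index at least `N` of a sequence. -/
def tailWeights (N : ℕ) : Set (ℕ →₀ ℝ) :=
  {w | (∀ n, 0 ≤ w n) ∧ (∀ n < N, w n = 0) ∧ Finsupp.linearCombination ℝ (fun _ => (1 : ℝ)) w = 1}

theorem convex_tailWeights (N : ℕ) : Convex ℝ (tailWeights N) := by
  rintro v ⟨hv0, hvN, hv1⟩ w ⟨hw0, hwN, hw1⟩ a b ha hb hab
  refine ⟨fun n => ?_, fun n hn => ?_, ?_⟩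
  · have := hv0 n
    have := hw0 n
    simp only [Finsupp.add_apply, Finsupp.smul_apply, smul_eq_mul]
    positivity
  · simp [hvN n hn, hwN n hn]
  · rw [map_add, map_smul, map_smul, hv1, hw1]
    simpa using hab

theorem sum_eq_one_of_mem_tailWeights {N : ℕ} {w : ℕ →₀ ℝ} (hw : w ∈ tailWeights N) :
    ∑ n ∈ w.support, w n = 1 := by
  have := hw.2.2
  rw [Finsupp.linearCombination_apply, Finsupp.sum] at this
  simpa using this

theorem le_of_mem_support_of_mem_tailWeights {N n : ℕ} {w : ℕ →₀ ℝ} (hw : w ∈ tailWeights N)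
    (hn : n ∈ w.support) : N ≤ n := by
  by_contra hlt
  exact Finsupp.mem_support_iff.1 hn (hw.2.1 n (not_le.1 hlt))

/-- If a bounded sequence of continuous functions on a compact space converges pointwise to zero,
then some convex combination of terms with large indices is less than `1` everywhere. -/
theorem exists_tailWeights_lt_one {K : Type*} [TopologicalSpace K] [CompactSpace K] [T2Space K]
    (h : ℕ → C(K, ℝ)) (B : ℝ) (hB : ∀ n z, |h n z| ≤ B)
    (hlim : ∀ z, Tendsto (fun n => h n z) atTop (𝓝 0)) (N : ℕ) :
    ∃ w ∈ tailWeights N, ∀ z, ∑ n ∈ w.support, w n * h n z < 1 := by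
  let S : Set C(K, ℝ) := {f | ∀ z, f z < 1}
  let T : Set C(K, ℝ) := Finsupp.linearCombination ℝ h '' tailWeights N
  by_contra! hcon
  have hSo : IsOpen S := by
    convert ContinuousMap.isOpen_setOfPred_mapsTo (isCompact_univ (X := K))
      (isOpen_Iio (a := (1 : ℝ))) using 1
    ext f
    simp [S, Set.MapsTo]
  have hSc : Convex ℝ S := by
    intro f hf g hg a b ha hb hab z
    exact (convex_Iio (1 : ℝ)) (hf z) (hg z) ha hb hab
  have hTc : Convex ℝ T := (convex_tailWeights N).linear_image _
  have hdisj : Disjoint S T := by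
    rw [Set.disjoint_left]
    rintro _ hf ⟨w, hw, rfl⟩
    obtain ⟨z, hz⟩ := hcon w hw
    have := hf z
    rw [Finsupp.linearCombination_apply, Finsupp.sum, ContinuousMap.sum_apply] at this
    simp only [ContinuousMap.smul_apply, smul_eq_mul] at this
    linarith
  obtain ⟨φ, s, hS, hT⟩ := geometric_hahn_banach_open hSc hSo hTc hdisj
  have hs : 0 < s := by
    simpa using hS 0 fun z => by simp
  have hpos : ∀ f : C(K, ℝ), 0 ≤ f → 0 ≤ φ f := by
    intro f hf
    by_contra! hneg
    -- This multiple of `f` is nonpositive, hence in `S`, yet `φ` equals `s` there.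
    have h1 := hS ((s / φ f) • f) fun z => by
      have h2 : 0 ≤ f z := hf z
      have h3 : s / φ f ≤ 0 := div_nonpos_of_nonneg_of_nonpos hs.le hneg.le
      simpa using (mul_nonpos_of_nonpos_of_nonneg h3 h2).trans_lt one_pos
    rw [map_smul, smul_eq_mul, div_mul_cancel₀ _ hneg.ne] at h1
    exact lt_irrefl _ h1
  -- Each `h n` with `n ≥ N` lies in `T`, so `φ (h n) ≥ s > 0`, against convergence to 0.
  have hlim' := tendsto_positive_functional_zero φ.toLinearMap hpos h B hB hlim
  refine hs.not_ge (ge_of_tendsto hlim' ?_)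
  filter_upwards [eventually_ge_atTop N] with n hn
  refine hT _ ⟨Finsupp.single n 1, ⟨fun m => ?_, fun m hm => ?_, by simp⟩, by simp⟩
  · by_cases hm : n = m
    · simp [hm]
    · simp [hm]
  · simp [(hm.trans_le hn).ne']

/-- If a bounded sequence of continuous functions on a compact space is, at each point, eventually
at most `c` in absolute value, then some convex combination of terms with large indices is at most
`c + 1` in absolute value everywhere. -/
theorem exists_tailWeights_abs_le {K : Type*} [TopologicalSpace K] [CompactSpace K] [T2Space K]
    (f : ℕ → C(K, ℝ)) (B c : ℝ) (hB : ∀ n z, |f n z| ≤ B)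
    (hlim : ∀ z, ∀ᶠ n in atTop, |f n z| ≤ c) (N : ℕ) :
    ∃ w ∈ tailWeights N, ∀ z, |∑ n ∈ w.support, w n * f n z| ≤ c + 1 := by
  -- The excess of `|f n|` over `c` eventually vanishes at each point.
  let h : ℕ → C(K, ℝ) := fun n => ⟨fun z => max (|f n z| - c) 0, by fun_prop⟩
  obtain ⟨w, hw, hlt⟩ := exists_tailWeights_lt_one h (B + |c|)
    (fun n z => by
      have h1 := hB n z
      have h2 := neg_abs_le c
      have h3 := abs_nonneg (f n z)
      have h4 := abs_nonneg c
      change |max (|f n z| - c) 0| ≤ B + |c|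
      rw [abs_of_nonneg (le_max_right _ _)]
      exact max_le (by linarith) (by linarith))
    (fun z => tendsto_const_nhds.congr' (by
      filter_upwards [hlim z] with n hn
      exact (max_eq_right (sub_nonpos.2 hn)).symm)) N
  refine ⟨w, hw, fun z => ?_⟩
  calc |∑ n ∈ w.support, w n * f n z|
      ≤ ∑ n ∈ w.support, |w n * f n z| := Finset.abs_sum_le_sum_abs _ _
    _ ≤ ∑ n ∈ w.support, (w n * c + w n * h n z) := by
        refine Finset.sum_le_sum fun n _ => ?_
        rw [abs_mul, abs_of_nonneg (hw.1 n), ← mul_add]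
        refine mul_le_mul_of_nonneg_left ?_ (hw.1 n)
        have : |f n z| - c ≤ h n z := le_max_left _ _
        linarith
    _ ≤ c + 1 := by
        rw [Finset.sum_add_distrib, ← Finset.sum_mul, sum_eq_one_of_mem_tailWeights hw, one_mul]
        have := hlt z
        linarith

/-- The convex combinations of a sequence with weights `w k` form a convex block subsequence when
the supports of the weights are successive. -/
theorem isConvexBlockSubsequence_of_tailWeights {E : Type*} [AddCommGroup E] [Module ℝ E]
    (x : ℕ → E) (w : ℕ → ℕ →₀ ℝ) (N : ℕ → ℕ) (hw : ∀ k, w k ∈ tailWeights (N k))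
    (hN : ∀ k, ∀ n ∈ (w k).support, n < N (k + 1)) :
    IsConvexBlockSubsequence (fun k => ∑ n ∈ (w k).support, w k n • x n) x := by
  have hmono : Monotone N := by
    refine monotone_nat_of_le_succ fun k => ?_
    have hne : (w k).support.Nonempty := by
      rw [Finset.nonempty_iff_ne_empty]
      intro h
      have := sum_eq_one_of_mem_tailWeights (hw k)
      simp [h] at this
    obtain ⟨n, hn⟩ := hne
    exact (le_of_mem_support_of_mem_tailWeights (hw k) hn).trans (hN k n hn).le
  have hdisj : ∀ j k n, n ∈ (w j).support → n ∈ (w k).support → ¬ j < k := by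
    intro j k n hj hk hjk
    have h1 := hN j n hj
    have h2 := le_of_mem_support_of_mem_tailWeights (hw k) hk
    have h3 := hmono (Nat.succ_le_of_lt hjk)
    simp only [Nat.succ_eq_add_one] at h3
    omega
  classical
  -- The supports are disjoint, so the chosen `k` is the only one; indices outside all blocks get 0.
  let a : ℕ → ℝ := fun n => if h : ∃ k, n ∈ (w k).support then w h.choose n else 0
  have ha : ∀ k, ∀ n ∈ (w k).support, a n = w k n := by
    intro k n hn
    have h : ∃ k, n ∈ (w k).support := ⟨k, hn⟩
    have hk : h.choose = k := le_antisymm (not_lt.1 (hdisj k _ n hn h.choose_spec))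
      (not_lt.1 (hdisj _ k n h.choose_spec hn))
    simp only [a, dif_pos h, hk]
  refine ⟨fun k => (w k).support, a, fun k i hi j hj => ?_, fun n => ?_, fun k => ?_, fun k => ?_⟩
  · exact (hN k i hi).trans_le (le_of_mem_support_of_mem_tailWeights (hw (k + 1)) hj)
  · by_cases h : ∃ k, n ∈ (w k).support
    · simp only [a, dif_pos h]
      exact (hw _).1 n
    · simp only [a, dif_neg h, le_refl]
  · rw [Finset.sum_congr rfl (ha k), sum_eq_one_of_mem_tailWeights (hw k)]
  · exact Finset.sum_congr rfl fun n hn => by rw [ha k n hn]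

/-! ### Functionals on ε-relatively weakly compact sets, and the Mackey topology -/

section

variable {X : Type*} [NormedAddCommGroup X] [NormedSpace ℝ X]

theorem isWeaklyCompact_isRelativelyWeaklyCompact {C : Set X} (hC : IsWeaklyCompact C) :
    IsRelativelyWeaklyCompact C := by
  unfold IsRelativelyWeaklyCompact
  rw [hC.isClosed.closure_eq]
  exact hC

/-- The `w*`-closure of a bounded set in the bidual is bounded. -/
theorem exists_closure_inclusionInDoubleDual_subset_closedBall {M : Set X}
    (hM : Bornology.IsBounded M) :
    ∃ R : ℝ, closure (StrongDual.toWeakDual '' (NormedSpace.inclusionInDoubleDual ℝ X '' M)) ⊆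
      WeakDual.toStrongDual ⁻¹' Metric.closedBall (0 : StrongDual ℝ (StrongDual ℝ X)) R := by
  obtain ⟨R, hR⟩ := hM.exists_norm_le
  refine ⟨R, closure_minimal ?_ (WeakDual.isClosed_closedBall 0 R)⟩
  rintro _ ⟨_, ⟨x, hx, rfl⟩, rfl⟩
  exact (mem_closedBall_zero_iff (a := NormedSpace.inclusionInDoubleDual ℝ X x)).2
    ((NormedSpace.double_dual_bound ℝ X x).trans (hR x hx))

/-- Given finitely many sets `M i`, each `ε i`-relatively weakly compact, and a bounded sequence of
functionals converging pointwise to zero, some convex combination of terms with large indices is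
bounded by `(B + 2) * ε i` on each of the sets `M i`. -/
theorem exists_tailWeights_bound_of_isEpsRelativelyWeaklyCompact {ι : Type*} [Finite ι]
    (M : ι → Set X) (ε : ι → ℝ) (hε : ∀ i, 0 < ε i)
    (hM : ∀ i, IsEpsRelativelyWeaklyCompact (ε i) (M i)) (f : ℕ → StrongDual ℝ X) (B : ℝ)
    (hB : ∀ n, ‖f n‖ ≤ B) (hf : ∀ x, Tendsto (fun n => f n x) atTop (𝓝 0)) (N : ℕ) :
    ∃ w ∈ tailWeights N, ∀ i, ∀ x ∈ M i,
      |∑ n ∈ w.support, w n * f n x| ≤ (B + 2) * ε i := by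
  let K : ι → Set (WeakDual ℝ (StrongDual ℝ X)) := fun i =>
    closure (StrongDual.toWeakDual '' (NormedSpace.inclusionInDoubleDual ℝ X '' M i))
  choose R hR using fun i =>
    exists_closure_inclusionInDoubleDual_subset_closedBall (hM i).1
  have : ∀ i, CompactSpace (K i) := fun i => isCompact_iff_compactSpace.1
    ((WeakDual.isCompact_closedBall 0 (R i)).of_isClosed_subset isClosed_closure (hR i))
  -- Rescaling by `(ε i)⁻¹` gives all the pieces the same eventual bound `B + 1`.
  let F : ℕ → C((Σ i, K i), ℝ) := fun n =>
    ⟨fun q => (ε q.1)⁻¹ * (q.2 : WeakDual ℝ (StrongDual ℝ X)) (f n),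
      continuous_sigma fun i => ((WeakDual.eval_continuous (f n)).comp
        (continuous_subtype_val (p := (· ∈ K i)))).const_mul (ε i)⁻¹⟩
  have hB0 : 0 ≤ B := (norm_nonneg _).trans (hB 0)
  obtain ⟨Q, hQ⟩ := (Set.finite_range fun i => (ε i)⁻¹ * (R i * B)).bddAbove
  obtain ⟨w, hw, hle⟩ := exists_tailWeights_abs_le F Q (B + 1)
    (by
      rintro n ⟨i, z, hz⟩
      refine le_trans ?_ (hQ ⟨i, rfl⟩)
      change |(ε i)⁻¹ * z (f n)| ≤ (ε i)⁻¹ * (R i * B)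
      rw [abs_mul, abs_of_pos (inv_pos.2 (hε i))]
      refine mul_le_mul_of_nonneg_left ?_ (inv_pos.2 (hε i)).le
      have hzR : ‖WeakDual.toStrongDual z‖ ≤ R i :=
        (mem_closedBall_zero_iff (a := WeakDual.toStrongDual z)).1 (hR i hz)
      exact ((WeakDual.toStrongDual z).le_opNorm (f n)).trans
        (mul_le_mul hzR (hB n) (norm_nonneg _) ((norm_nonneg (WeakDual.toStrongDual z)).trans hzR)))
    (by
      rintro ⟨i, z, hz⟩
      obtain ⟨x, b, hb, hzx⟩ := (hM i).2 (WeakDual.toStrongDual z) hz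
      have hx := (hf x).abs
      rw [abs_zero] at hx
      filter_upwards [hx.eventually (ge_mem_nhds (hε i))] with n hn
      change |(ε i)⁻¹ * (WeakDual.toStrongDual z) (f n)| ≤ B + 1
      rw [hzx, abs_mul, abs_of_pos (inv_pos.2 (hε i)), inv_mul_le_iff₀ (hε i)]
      have h1 : |b (f n)| ≤ B := by
        refine (b.le_opNorm (f n)).trans ?_
        nlinarith [norm_nonneg b, norm_nonneg (f n), hB n]
      calc |f n x + ε i * b (f n)| ≤ |f n x| + |ε i * b (f n)| := abs_add_le _ _
        _ = |f n x| + ε i * |b (f n)| := by rw [abs_mul, abs_of_pos (hε i)]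
        _ ≤ ε i + ε i * B := add_le_add hn (mul_le_mul_of_nonneg_left h1 (hε i).le)
        _ = ε i * (B + 1) := by ring) N
  refine ⟨w, hw, fun i x hx => ?_⟩
  have h1 := hle ⟨i, StrongDual.toWeakDual (NormedSpace.inclusionInDoubleDual ℝ X x),
    subset_closure ⟨_, ⟨x, hx, rfl⟩, rfl⟩⟩
  have h2 : ∑ n ∈ w.support, w n * ((ε i)⁻¹ * f n x) =
      (ε i)⁻¹ * ∑ n ∈ w.support, w n * f n x := by
    rw [Finset.mul_sum]
    exact Finset.sum_congr rfl fun n _ => by ring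
  change |∑ n ∈ w.support, w n * ((ε i)⁻¹ * f n x)| ≤ B + 1 + 1 at h1
  rw [h2, abs_mul, abs_of_pos (inv_pos.2 (hε i)), inv_mul_le_iff₀ (hε i)] at h1
  linarith

theorem tendsto_mackeyTopology_of_tendstoUniformlyOn {y : ℕ → StrongDual ℝ X}
    {l : StrongDual ℝ X}
    (h : ∀ C : Set X, IsWeaklyCompact C → TendstoUniformlyOn (fun k x => y k x) l atTop C) :
    Tendsto y atTop (@nhds _ (mackeyTopology X) l) := by
  rw [nhds_induced, tendsto_comap_iff, UniformConvergenceCLM.tendsto_iff_tendstoUniformlyOn]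
  exact h

end

theorem mainTheorem7 (X : Type*) [NormedAddCommGroup X] [NormedSpace ℝ X] [CompleteSpace X]
    (hX : HasPropertyKM X) : HasPropertyK X := by
  obtain ⟨M, hM, hcov⟩ := hX
  rintro x ⟨l, hl⟩
  have hpt : ∀ v, Tendsto (fun n => x n v) atTop (𝓝 (l v)) := fun v =>
    ((WeakDual.eval_continuous v).tendsto _).comp hl
  have hf : ∀ v, Tendsto (fun n => (x n - l) v) atTop (𝓝 0) := fun v => by
    simpa using (hpt v).sub_const (l v)
  obtain ⟨B, hB⟩ := banach_steinhaus (g := fun n => x n - l) fun v => by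
    obtain ⟨c, hc⟩ := ((hf v).norm).bddAbove_range
    exact ⟨c, fun n => hc ⟨n, rfl⟩⟩
  have hB0 : 0 ≤ B := (norm_nonneg _).trans (hB 0)
  have hstep : ∀ k N : ℕ, ∃ w ∈ tailWeights N, ∀ n p : ℕ+, n ≤ k → p ≤ k → ∀ v ∈ M n p,
      |∑ m ∈ w.support, w m * (x m - l) v| ≤ (B + 2) * (1 / p) := by
    intro k N
    obtain ⟨w, hw, h⟩ := exists_tailWeights_bound_of_isEpsRelativelyWeaklyCompact
      -- `Fin k` shifted by one enumerates the positive integers up to `k`.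
      (ι := Fin k × Fin k) (fun i => M i.1.1.succPNat i.2.1.succPNat)
      (fun i => 1 / (i.2.1.succPNat : ℝ)) (fun i => by positivity) (fun i => hM _ _)
      (fun n => x n - l) B hB hf N
    refine ⟨w, hw, fun n p hn hp v hv => ?_⟩
    have := h (⟨n.natPred, by have := n.natPred_add_one; omega⟩,
      ⟨p.natPred, by have := p.natPred_add_one; omega⟩) v
    simp only [PNat.succPNat_natPred] at this
    exact this hv
  choose w hw hwM using hstep
  -- Each block starts strictly beyond the support of the previous one.
  let N : ℕ → ℕ := fun k => Nat.rec 0 (fun k N => (w k N).support.sup id + 1) k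
  let u : ℕ → ℕ →₀ ℝ := fun k => w k (N k)
  have hu : ∀ k, u k ∈ tailWeights (N k) := fun k => hw k (N k)
  refine ⟨_, isConvexBlockSubsequence_of_tailWeights x u N hu fun k n hn =>
    Nat.lt_succ_of_le (Finset.le_sup (f := id) hn), l, ?_⟩
  refine tendsto_mackeyTopology_of_tendstoUniformlyOn fun C hC => ?_
  rw [Metric.tendstoUniformlyOn_iff]
  intro δ hδ
  -- With `p = q`, the block bound `(B + 2) / p` is below `δ`.
  obtain ⟨q, hq⟩ := exists_nat_gt ((B + 2) / δ)
  have hq0 : 0 < q := by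
    have : (0 : ℝ) < q := lt_of_le_of_lt (by positivity) hq
    exact_mod_cast this
  let p : ℕ+ := ⟨q, hq0⟩
  obtain ⟨n, hn⟩ := hcov C (isWeaklyCompact_isRelativelyWeaklyCompact hC) p
  filter_upwards [eventually_ge_atTop (n : ℕ), eventually_ge_atTop (p : ℕ)] with k hkn hkp v hv
  have h1 := hwM k (N k) n p hkn hkp v (hn hv)
  have h2 : ∑ m ∈ (u k).support, u k m * (x m - l) v =
      (∑ m ∈ (u k).support, u k m • x m) v - l v := by
    simp only [sub_apply, mul_sub, Finset.sum_sub_distrib, ← Finset.sum_mul,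
      sum_eq_one_of_mem_tailWeights (hu k), one_mul, sum_apply,
      smul_apply, smul_eq_mul]
  rw [dist_comm, Real.dist_eq, ← h2]
  refine h1.trans_lt ?_
  rw [mul_one_div]
  exact (div_lt_comm₀ hδ (by exact_mod_cast hq0)).1 hq
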